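/- Theorem 2 (Outer Bound). Consider the Gaussian multicast channel with two transmitters, $K\ge 1$ receivers and feedback. For fixed channel gains $g_{mk}\in\mathbb{C}$, receiver $k$ observes at time $i$ the signal $Y_{ki}=g_{1k}X_{1i}+g_{2k}X_{2i}+Z_{ki}$, where the noises $Z_{ki}\sim\mathcal{CN}(0,1)$ are independent over all receivers $k$ and times $i$. The messages $W_1,W_2$ are independent, uniformly distributed on $\{1,\dots,\lceil 2^{NR_m}\rceil\}$, $m=1,2$, respectively, and independent of the noise. Transmitter $m$ sends $X_{mi}=f_{mi}(W_m,Y_1^{i-1},\dots,Y_K^{i-1})$, where $Y_k^{i-1}=(Y_{k1},\dots,Y_{k,i-1})$, subject to the power constraint $\frac1N\sum_{i=1}^N E|X_{mi}|^2\le 1$; receiver $k$ estimates both messages from $Y_k^N$. A pair $(R_1,R_2)$ with $R_1,R_2\ge 0$ is achievable if there are such codes of block lengths $N=1,2,\dots$ for which the average probability of decoding error of every receiver tends to $0$ as $N\to\infty$. The feedback capacity region $\mathcal{C}$ is the closure of the set of achievable pairs. Let $\mathsf{SNR}_{mk}=|g_{mk}|^2$ and let $\log$ denote the logarithm to base $2$.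 Then for every $(R_1,R_2)\in\mathcal{C}$ there is a $\rho\in[0,1]$ such that \begin{align*} R_1&\le\log\Bigl(1+(1-\rho^2)\sum_{i=1}^K\mathsf{SNR}_{1i}\Bigr),\\ R_2&\le\log\Bigl(1+(1-\rho^2)\sum_{i=1}^K\mathsf{SNR}_{2i}\Bigr),\\ R_1+R_2&\le\log\Bigl(1+\mathsf{SNR}_{1k}+\mathsf{SNR}_{2k}+2\rho\sqrt{\mathsf{SNR}_{1k}\,\mathsf{SNR}_{2k}}\Bigr)\quad\text{for all }k\in\{1,\dots,K\}. \end{align*} -/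

import Mathlib

open MeasureTheory ProbabilityTheory Filter Topology

namespace GaussianMulticast

noncomputable section

/-- The circularly symmetric complex Gaussian law `CN(0,1)`: the real and the imaginary parts are
independent real Gaussians of mean `0` and variance `1/2`. -/
def stdComplexGaussian : Measure ℂ :=
  ((gaussianReal 0 (1 / 2)).prod (gaussianReal 0 (1 / 2))).map
    (fun p : ℝ × ℝ => (⟨p.1, p.2⟩ : ℂ))

/-- The law of the noise over a block of length `N`: the `Z_{ki}` are independent over the times `i`
and the receivers `k`, each with law `CN(0,1)`. -/
def noiseLaw (K N : ℕ) : Measure (Fin N → Fin K → ℂ) :=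
  Measure.pi fun _ => Measure.pi fun _ => stdComplexGaussian

/-- A feedback code of block length `N` for two transmitters and `K` receivers; transmitter `m` has
`L m` messages. At time `i`, it sends a symbol that depends on its own message and on the signals
received by all receivers at the times before `i`; `encode m i w y` is this symbol. Receiver `k`
estimates both messages from the `N` signals it has received. -/
structure FeedbackCode (K N : ℕ) (L : Fin 2 → ℕ) where
  encode : (m : Fin 2) → (i : Fin N) → Fin (L m) → (Fin i → Fin K → ℂ) → ℂ
  measurable_encode : ∀ m i w, Measurable (encode m i w)
  decode : Fin K → (Fin N → ℂ) → (m : Fin 2) → Fin (L m)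
  measurable_decode : ∀ k, Measurable (decode k)

namespace FeedbackCode

variable {K N : ℕ} {L : Fin 2 → ℕ}

/-- The signal `Y_{ki}` of receiver `k` at time `i`, for the channel gains `g m k`, the messages `w`
and the noise `z`:  `Y_{ki} = ∑ m, g m k * X_{mi} + Z_{ki}`  with
`X_{mi} = encode m i (w m) (Y^{i-1})`. -/
def received (c : FeedbackCode K N L) (g : Fin 2 → Fin K → ℂ) (w : (m : Fin 2) → Fin (L m))
    (z : Fin N → Fin K → ℂ) (i : Fin N) (k : Fin K) : ℂ :=
  (∑ m, g m k * c.encode m i (w m)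
    (fun t k' => received c g w z ⟨t.1, t.2.trans i.2⟩ k')) + z i k
termination_by i.1
decreasing_by exact t.2

/-- The symbol `X_{mi}` sent by transmitter `m` at time `i`. -/
def sent (c : FeedbackCode K N L) (g : Fin 2 → Fin K → ℂ) (w : (m : Fin 2) → Fin (L m))
    (z : Fin N → Fin K → ℂ) (m : Fin 2) (i : Fin N) : ℂ :=
  c.encode m i (w m) (fun t k => c.received g w z ⟨t.1, t.2.trans i.2⟩ k)

end FeedbackCode

/-- The joint law of messages and noise: the two messages are independent and uniform, and
independent of the noise. -/
def messageNoiseLaw (K N : ℕ) (L : Fin 2 → ℕ) :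
    Measure (((m : Fin 2) → Fin (L m)) × (Fin N → Fin K → ℂ)) :=
  (uniformOn Set.univ).prod (noiseLaw K N)

namespace FeedbackCode

variable {K N : ℕ} {L : Fin 2 → ℕ}

/-- The power constraint `(1/N) ∑ i, E|X_{mi}|² ≤ 1` of both transmitters, the expectation being
over the messages and the noise. -/
def PowerConstraint (c : FeedbackCode K N L) (g : Fin 2 → Fin K → ℂ) : Prop :=
  ∀ m, ∑ i, ∫⁻ q, ‖c.sent g q.1 q.2 m i‖ₑ ^ 2 ∂(messageNoiseLaw K N L) ≤ N

/-- The probability that the estimate made by receiver `k` of the message pair is wrong, averaged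
over the messages. -/
def errorProb (c : FeedbackCode K N L) (g : Fin 2 → Fin K → ℂ) (k : Fin K) : ENNReal :=
  messageNoiseLaw K N L {q | c.decode k (fun i => c.received g q.1 q.2 i k) ≠ q.1}

end FeedbackCode

/-- The number `2 ^ (N R)` of messages, rounded up to an integer. -/
def numMessages (R : Fin 2 → ℝ) (N : ℕ) (m : Fin 2) : ℕ := ⌈(2 : ℝ) ^ ((N : ℝ) * R m)⌉₊

/-- A pair of nonnegative rates (in bits per channel use) is achievable if some sequence of
feedback codes with these rates obeys the power constraint and has, at every receiver, an average
error probability that tends to zero. -/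
def Achievable {K : ℕ} (g : Fin 2 → Fin K → ℂ) (R : Fin 2 → ℝ) : Prop :=
  (∀ m, 0 ≤ R m) ∧
    ∃ c : (N : ℕ) → FeedbackCode K N (numMessages R N),
      (∀ N, (c N).PowerConstraint g) ∧
        ∀ k, Tendsto (fun N => (c N).errorProb g k) atTop (𝓝 0)

/-- The feedback capacity region: the closure of the set of achievable rate pairs. -/
def capacityRegion {K : ℕ} (g : Fin 2 → Fin K → ℂ) : Set (Fin 2 → ℝ) :=
  closure {R | Achievable g R}

/-- The signal-to-noise ratio of transmitter `m` at receiver `k`. -/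
def SNR {K : ℕ} (g : Fin 2 → Fin K → ℂ) (m : Fin 2) (k : Fin K) : ℝ := ‖g m k‖ ^ 2

/-- The rate pairs that satisfy the cut-set bounds for a common correlation `ρ ∈ [0, 1]`. -/
def outerRegion {K : ℕ} (g : Fin 2 → Fin K → ℂ) : Set (Fin 2 → ℝ) :=
  {R | ∃ ρ : ℝ, 0 ≤ ρ ∧ ρ ≤ 1 ∧
    R 0 ≤ Real.logb 2 (1 + (1 - ρ ^ 2) * ∑ i, SNR g 0 i) ∧
    R 1 ≤ Real.logb 2 (1 + (1 - ρ ^ 2) * ∑ i, SNR g 1 i) ∧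
    ∀ k, R 0 + R 1 ≤
      Real.logb 2 (1 + SNR g 0 k + SNR g 1 k + 2 * ρ * Real.sqrt (SNR g 0 k * SNR g 1 k))}

end

end GaussianMulticast

/-!
The outer bound is a change-of-measure form of the cut-set converse; no differential entropy or
mutual information is needed.

Let `P` be the law of messages and noise, and let `Q` be another law under which the data that a
decoder uses are independent of the message to be found. The decoder is then right with
`Q`-probability at most `1 / L`, where `L` is the number of messages, and Jensen's inequality for the
logarithm gives `P(correct) log L ≤ log 2 + E_P[log dP/dQ]` (`measureReal_mul_log_le`).

In each of the three bounds the relevant data are a causally shifted noise `v i = z i + β i • h`,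
where the scalar `β i` depends on the messages and on the noise before time `i`. For the bound on
the rate of transmitter `m`, the vector `h` is the gain vector of `m` and `β i` is the error of a
linear prediction of its symbol from the symbol of the other transmitter `m'`: once the predicted
part is absorbed into the gains of `m'`, the sequence `v` acts as the noise of a channel on which only
`m'` is active, and so the output is a function of `v` and the message of `m'`
(`individual_rate_bound`). For the sum rate at receiver `k`, the vector `h` is the `k`-th unit vector
and `β i` is the noiseless signal of this receiver, so that coordinate `k` of `v` is the received
signal (`sum_rate_bound`). In both cases `Q` is the law that makes the `v i` independent
`CN(0, I + σ h hᴴ)` vectors, independent of the messages. It exists by the Cameron–Martin formula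
applied at each time given the past (`map_causal_shift`, `map_prod_tilt`), and if `σ` is the bound on
the average power of `β` then `E_P[log dP/dQ] ≤ N log (1 + σ ‖h‖²)`
(`measureReal_shift_mul_log_le`). One `σ` serves all times, so no concavity argument is needed.

With `λ` the time average of `E[X₁ X̄₂]` and `ρ = |λ|`, the coefficients `λ` and `λ̄` predict each
symbol from the other one with mean error power at most `1 - ρ²`, because both powers are at most
`1`; and the mean signal power at receiver `k` is at most
`SNR₁ + SNR₂ + 2 ρ √(SNR₁ SNR₂)` (`exists_correlation`). The region is closed, since `ρ` ranges over
a compact interval, so the bounds pass to the limit of long blocks and to the closure of the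
achievable pairs.
-/

namespace GaussianMulticast

/-! ### Causal shifts of product measures -/

section CausalShift

variable {E : Type*} [MeasurableSpace E]

/-- Resampling one coordinate of an i.i.d. vector does not change its law. All conditioning on the
past is done by integrating out one coordinate in this way. -/
lemma measurePreserving_update {ι : Type*} [Fintype ι] [DecidableEq ι] (ν : Measure E)
    [IsProbabilityMeasure ν] (i : ι) :
    MeasurePreserving (fun p : (ι → E) × E => Function.update p.1 i p.2)
      ((Measure.pi fun _ => ν).prod ν) (Measure.pi fun _ => ν) := by
  have hm : Measurable (fun p : (ι → E) × E => Function.update p.1 i p.2) := by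
    rw [measurable_pi_iff]
    intro j
    by_cases h : j = i
    · subst h; simpa using measurable_snd
    · simpa [Function.update_of_ne h, Function.comp_def] using
        (measurable_pi_apply (X := fun _ => E) j).comp (measurable_fst (β := E))
  refine ⟨hm, (Measure.pi_eq fun s hs => ?_).symm⟩
  rw [Measure.map_apply hm (MeasurableSet.univ_pi hs)]
  have : (fun p : (ι → E) × E => Function.update p.1 i p.2) ⁻¹' Set.univ.pi s
      = (Set.univ.pi (Function.update s i Set.univ)) ×ˢ s i := by
    ext ⟨z, u⟩
    simp only [Set.mem_preimage, Set.mem_pi, Set.mem_univ, true_implies, Set.mem_prod]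
    constructor
    · intro h
      refine ⟨fun j => ?_, by simpa using h i⟩
      by_cases hj : j = i
      · subst hj; simp
      · simpa [hj] using h j
    · rintro ⟨h, h'⟩ j
      by_cases hj : j = i
      · subst hj; simpa using h'
      · simpa [hj] using h j
  rw [this, Measure.prod_prod, Measure.pi_pi, ← Finset.mul_prod_erase _ _ (Finset.mem_univ i),
    ← Finset.mul_prod_erase Finset.univ (fun j => ν (s j)) (Finset.mem_univ i)]
  simp only [Function.update_self, measure_univ, one_mul]
  rw [mul_comm]
  congr 1
  exact Finset.prod_congr rfl fun j hj => by rw [Function.update_of_ne (Finset.ne_of_mem_erase hj)]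

lemma lintegral_pi_update {ι : Type*} [Fintype ι] [DecidableEq ι] (ν : Measure E)
    [IsProbabilityMeasure ν] (i : ι) {f : (ι → E) → ENNReal} (hf : Measurable f) :
    ∫⁻ z, f z ∂(Measure.pi fun _ => ν)
      = ∫⁻ z, ∫⁻ u, f (Function.update z i u) ∂ν ∂(Measure.pi fun _ => ν) := by
  have h := measurePreserving_update (ι := ι) ν i
  rw [← h.lintegral_comp hf]
  exact lintegral_prod _ (hf.comp h.measurable).aemeasurable

/-- A product of causal factors, each of constant conditional mean given the past, integrates to
the product of these constants: integrate out the last coordinate and repeat. -/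
lemma lintegral_prod_causal {N : ℕ} (ν : Measure E) [IsProbabilityMeasure ν]
    (φ : Fin N → (Fin N → E) → E → ENNReal)
    (hφ : ∀ i, Measurable fun p : (Fin N → E) × E => φ i p.1 p.2)
    (hc : ∀ i j, i ≤ j → ∀ z u, φ i (Function.update z j u) = φ i z)
    (κ : Fin N → ENNReal) (hκ : ∀ i z, ∫⁻ u, φ i z u ∂ν = κ i) :
    ∫⁻ z, ∏ i, φ i z (z i) ∂(Measure.pi fun _ => ν) = ∏ i, κ i := by
  have hm : ∀ i, Measurable fun z : Fin N → E => φ i z (z i) := fun i =>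
    (hφ i).comp (measurable_id.prodMk (measurable_pi_apply i))
  suffices H : ∀ n ≤ N, ∫⁻ z, ∏ i with i.1 < n, φ i z (z i) ∂(Measure.pi fun _ => ν)
      = ∏ i with i.1 < n, κ i by
    have := H N le_rfl
    simpa using this
  intro n
  induction n with
  | zero => intro _; simp
  | succ n ih =>
    intro hn
    have hS : (Finset.univ.filter fun i : Fin N => i.1 < n + 1)
        = insert ⟨n, hn⟩ (Finset.univ.filter fun i : Fin N => i.1 < n) := by
      ext i; simp [Fin.ext_iff]; omega
    have hnot : (⟨n, hn⟩ : Fin N) ∉ Finset.univ.filter fun i : Fin N => i.1 < n := by simp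
    simp only [hS, Finset.prod_insert hnot]
    have hP : Measurable fun z : Fin N → E => ∏ i with i.1 < n, φ i z (z i) :=
      Finset.measurable_fun_prod _ fun i _ => hm i
    have hP' : Measurable fun z : Fin N → E =>
        φ ⟨n, hn⟩ z (z ⟨n, hn⟩) * ∏ i with i.1 < n, φ i z (z i) := (hm _).mul hP
    rw [lintegral_pi_update ν ⟨n, hn⟩ hP',
      ← ih (by omega), ← lintegral_const_mul _ hP]
    refine lintegral_congr fun z => ?_
    have : ∀ u, ∏ i with i.1 < n, φ i (Function.update z ⟨n, hn⟩ u)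
        (Function.update z ⟨n, hn⟩ u i) = ∏ i with i.1 < n, φ i z (z i) := fun u => by
      refine Finset.prod_congr rfl fun i hi => ?_
      have hi' : i.1 < n := by simpa using hi
      rw [hc i _ (Fin.le_def.2 hi'.le), Function.update_of_ne (by simp [Fin.ext_iff]; omega)]
    simp only [this, hc _ _ le_rfl, Function.update_self]
    have hz : Measurable (φ ⟨n, hn⟩ z) := (hφ _).comp measurable_prodMk_left
    rw [lintegral_mul_const _ hz, hκ]

variable [AddGroup E] [MeasurableAdd₂ E]

/-- If, for every constant shift `b`, the density `τ b` turns the law of `z + b` from a translate of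
`ν` into `μ`, then the product of these densities along a causal shift of i.i.d. noise makes the
shifted sequence i.i.d. with law `μ`, however the shifts depend on the past. -/
lemma map_causal_shift {N : ℕ} (ν μ : Measure E) [IsProbabilityMeasure ν] [SigmaFinite μ]
    (τ : E → E → ENNReal) (hτ : Measurable fun p : E × E => τ p.1 p.2)
    (hτμ : ∀ b, (ν.withDensity (τ b)).map (· + b) = μ)
    (b : Fin N → (Fin N → E) → E) (hb : ∀ i, Measurable (b i))
    (hc : ∀ i j, i ≤ j → ∀ z u, b i (Function.update z j u) = b i z) :
    ((Measure.pi fun _ => ν).withDensity fun z => ∏ i, τ (b i z) (z i)).map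
      (fun z i => z i + b i z) = Measure.pi fun _ => μ := by
  have hV : Measurable fun (z : Fin N → E) i => z i + b i z :=
    measurable_pi_lambda _ fun i => (measurable_pi_apply i).add (hb i)
  refine (Measure.pi_eq fun s hs => ?_).symm
  have hs' := MeasurableSet.univ_pi hs
  rw [Measure.map_apply hV hs', withDensity_apply _ (hV hs'), ← lintegral_indicator (hV hs')]
  rw [← lintegral_prod_causal ν
    (fun i z u => τ (b i z) u * (s i).indicator 1 (u + b i z)) (fun i => ?_) (fun i j hij z u => ?_)
    (fun i => μ (s i)) (fun i z => ?_)]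
  · refine lintegral_congr fun z => ?_
    rw [Finset.prod_mul_distrib]
    by_cases hz : ∀ i, z i + b i z ∈ s i
    · rw [Set.indicator_of_mem (by simpa using hz)]
      simp [hz]
    · rw [Set.indicator_of_notMem (by simpa using hz)]
      push Not at hz
      obtain ⟨i, hi⟩ := hz
      rw [Finset.prod_eq_zero (f := fun i => (s i).indicator 1 (z i + b i z)) (Finset.mem_univ i)
        (by simp [hi]), mul_zero]
  · have h1 : Measurable fun p : (Fin N → E) × E => b i p.1 := (hb i).comp measurable_fst
    exact (hτ.comp (h1.prodMk measurable_snd)).mul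
      ((measurable_one.indicator (hs i)).comp (measurable_snd.add h1))
  · simp only [hc i j hij]
  · have h2 : Measurable fun u : E => u + b i z := measurable_id.add_const _
    have h3 : Measurable (τ (b i z)) := hτ.comp measurable_prodMk_left
    rw [← hτμ (b i z), Measure.map_apply h2 (hs i), withDensity_apply _ (h2 (hs i)),
      ← lintegral_indicator (h2 (hs i))]
    refine lintegral_congr fun u => ?_
    by_cases hu : u + b i z ∈ s i <;> simp [hu]

end CausalShift

/-! ### The complex Gaussian law -/

section Gaussian

lemma measurable_complex_mk : Measurable fun p : ℝ × ℝ => (⟨p.1, p.2⟩ : ℂ) :=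
  Complex.measurableEquivRealProd.symm.measurable

instance : IsProbabilityMeasure stdComplexGaussian :=
  Measure.isProbabilityMeasure_map measurable_complex_mk.aemeasurable

lemma stdComplexGaussian_eq_withDensity :
    stdComplexGaussian
      = volume.withDensity fun z : ℂ => ENNReal.ofReal (Real.pi⁻¹ * Real.exp (-‖z‖ ^ 2)) := by
  have hf : Measurable fun z : ℂ => ENNReal.ofReal (Real.pi⁻¹ * Real.exp (-‖z‖ ^ 2)) := by
    fun_prop
  have hvol : (volume : Measure ℂ)
      = (volume : Measure (ℝ × ℝ)).map fun p : ℝ × ℝ => (⟨p.1, p.2⟩ : ℂ) :=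
    (Complex.volume_preserving_equiv_real_prod.symm _).map_eq.symm
  ext s hs
  rw [stdComplexGaussian, Measure.map_apply measurable_complex_mk hs, withDensity_apply _ hs, hvol,
    setLIntegral_map hs hf measurable_complex_mk, gaussianReal_of_var_ne_zero _ (by norm_num),
    prod_withDensity (measurable_gaussianPDF _ _) (measurable_gaussianPDF _ _),
    withDensity_apply _ (measurable_complex_mk hs)]
  refine lintegral_congr fun p => ?_
  rw [gaussianPDF, gaussianPDF, ← ENNReal.ofReal_mul (gaussianPDFReal_nonneg _ _ _)]
  congr 1
  simp only [gaussianPDFReal]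
  have h1 : Real.sqrt (2 * Real.pi * ((1 / 2 : NNReal) : ℝ)) = Real.sqrt Real.pi := by
    congr 1; push_cast; ring
  rw [h1, ← Complex.normSq_eq_norm_sq, Complex.normSq_apply]
  have h2 : (Real.sqrt Real.pi)⁻¹ * (Real.sqrt Real.pi)⁻¹ = Real.pi⁻¹ := by
    rw [← mul_inv, Real.mul_self_sqrt Real.pi_pos.le]
  rw [mul_mul_mul_comm, h2, ← Real.exp_add]
  congr 2
  push_cast
  ring

lemma lintegral_exp_mul_normSq_stdComplexGaussian {s : ℝ} (hs : s < 1) :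
    ∫⁻ z, ENNReal.ofReal (Real.exp (s * ‖z‖ ^ 2)) ∂stdComplexGaussian
      = ENNReal.ofReal ((1 - s)⁻¹) := by
  have h1 : 0 < 1 - s := by linarith
  have hI := GaussianFourier.integral_rexp_neg_mul_sq_norm (V := ℂ) h1
  have hint : Integrable fun z : ℂ => Real.exp (-(1 - s) * ‖z‖ ^ 2) := by
    refine Integrable.of_integral_ne_zero ?_
    rw [hI]
    positivity
  rw [stdComplexGaussian_eq_withDensity, lintegral_withDensity_eq_lintegral_mul _ (by fun_prop)
    (by fun_prop)]
  have h2 : ∀ z : ℂ, ((fun z : ℂ => ENNReal.ofReal (Real.pi⁻¹ * Real.exp (-‖z‖ ^ 2))) *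
      fun z : ℂ => ENNReal.ofReal (Real.exp (s * ‖z‖ ^ 2))) z
      = ENNReal.ofReal (Real.pi⁻¹ * Real.exp (-(1 - s) * ‖z‖ ^ 2)) := fun z => by
    have := Real.pi_pos
    rw [Pi.mul_apply, ← ENNReal.ofReal_mul (by positivity), mul_assoc, ← Real.exp_add]
    ring_nf
  simp only [h2]
  rw [← ofReal_integral_eq_lintegral_ofReal (hint.const_mul _)
    (ae_of_all _ fun z => by have := Real.pi_pos; positivity), integral_const_mul, hI]
  congr 1
  have := Real.pi_pos
  simp [Complex.finrank_real_complex]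
  field_simp

/-- The Cameron–Martin formula for `CN(0,1)`. -/
lemma map_add_stdComplexGaussian (b : ℂ) :
    (stdComplexGaussian.withDensity fun z =>
      ENNReal.ofReal (Real.exp (‖z‖ ^ 2 - ‖z + b‖ ^ 2))).map (· + b) = stdComplexGaussian := by
  have hm : Measurable fun z : ℂ => z + b := by fun_prop
  rw [stdComplexGaussian_eq_withDensity, ← withDensity_mul _ (by fun_prop) (by fun_prop)]
  ext s hs
  rw [Measure.map_apply hm hs, withDensity_apply _ (hm hs), withDensity_apply _ hs,
    ← lintegral_indicator (hm hs), ← lintegral_indicator hs,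
    ← lintegral_add_right_eq_self (s.indicator _) b]
  refine lintegral_congr fun z => ?_
  by_cases hz : z + b ∈ s
  · rw [Set.indicator_of_mem (by simpa using hz), Set.indicator_of_mem hz, Pi.mul_apply,
      ← ENNReal.ofReal_mul (by have := Real.pi_pos; positivity), mul_assoc, ← Real.exp_add]
    ring_nf
  · rw [Set.indicator_of_notMem (by simpa using hz), Set.indicator_of_notMem hz]

end Gaussian

/-! ### Gaussian vectors -/

section VectorGaussian

variable {K : ℕ}

/-- The law of a vector of `K` independent `CN(0,1)` variables. -/
noncomputable abbrev vectorNoise (K : ℕ) : Measure (Fin K → ℂ) :=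
  Measure.pi fun _ => stdComplexGaussian

/-- The squared Euclidean norm of a complex vector (the norm of `Fin K → ℂ` is the sup norm). -/
noncomputable def normSq (z : Fin K → ℂ) : ℝ := ∑ k, ‖z k‖ ^ 2

lemma normSq_nonneg (z : Fin K → ℂ) : 0 ≤ normSq z :=
  Finset.sum_nonneg fun _ _ => by positivity

@[fun_prop]
lemma measurable_normSq : Measurable (normSq : (Fin K → ℂ) → ℝ) := by
  unfold normSq; fun_prop

@[fun_prop]
lemma measurable_dotProduct (a : Fin K → ℂ) : Measurable fun z : Fin K → ℂ => a ⬝ᵥ z := by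
  unfold dotProduct; fun_prop

lemma star_dotProduct_self (h : Fin K → ℂ) : star h ⬝ᵥ h = (normSq h : ℂ) := by
  simp only [dotProduct, normSq, Pi.star_apply, Complex.ofReal_sum]
  refine Finset.sum_congr rfl fun k _ => ?_
  rw [← Complex.normSq_eq_norm_sq, Complex.normSq_eq_conj_mul_self, Complex.star_def]

lemma norm_add_sq_complex (z b : ℂ) :
    ‖z + b‖ ^ 2 = ‖z‖ ^ 2 + 2 * (star b * z).re + ‖b‖ ^ 2 := by
  simp only [← Complex.normSq_eq_norm_sq, Complex.normSq_apply, Complex.add_re, Complex.add_im,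
    Complex.star_def, Complex.mul_re, Complex.conj_re, Complex.conj_im]
  ring

lemma normSq_add (z b : Fin K → ℂ) :
    normSq (z + b) = normSq z + 2 * (star b ⬝ᵥ z).re + normSq b := by
  simp only [normSq, Pi.add_apply, norm_add_sq_complex, Finset.sum_add_distrib, dotProduct,
    Pi.star_apply, Complex.re_sum, Finset.mul_sum]

lemma normSq_smul (a : ℂ) (h : Fin K → ℂ) : normSq (a • h) = ‖a‖ ^ 2 * normSq h := by
  simp [normSq, Finset.mul_sum, mul_pow]

/-- The Cameron–Martin formula for `CN(0,I)`. The coordinates are treated as successive times, with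
constant shifts. -/
lemma map_add_vectorNoise (b : Fin K → ℂ) :
    ((vectorNoise K).withDensity fun z => ENNReal.ofReal (Real.exp (normSq z - normSq (z + b)))).map
      (· + b) = vectorNoise K := by
  have := map_causal_shift (N := K) stdComplexGaussian stdComplexGaussian
    (fun b z => ENNReal.ofReal (Real.exp (‖z‖ ^ 2 - ‖z + b‖ ^ 2))) (by fun_prop)
    map_add_stdComplexGaussian (fun k _ => b k) (fun k => measurable_const) (fun _ _ _ _ _ => rfl)
  refine Eq.trans ?_ this
  congr 2
  ext z
  rw [← ENNReal.ofReal_prod_of_nonneg fun _ _ => (Real.exp_pos _).le, ← Real.exp_sum,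
    Finset.sum_sub_distrib]
  rfl

/-- The moment generating function of `CN(0,1)`: the density in the Cameron–Martin formula has total
mass `1`. -/
lemma lintegral_exp_two_re_stdComplexGaussian (a : ℂ) :
    ∫⁻ z, ENNReal.ofReal (Real.exp (2 * (star a * z).re)) ∂stdComplexGaussian
      = ENNReal.ofReal (Real.exp (‖a‖ ^ 2)) := by
  have h := congrArg (fun μ : Measure ℂ => μ Set.univ) (map_add_stdComplexGaussian (-a))
  simp only [measure_univ] at h
  rw [Measure.map_apply (by fun_prop) MeasurableSet.univ, Set.preimage_univ,
    withDensity_apply _ MeasurableSet.univ, setLIntegral_univ] at h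
  rw [← mul_one (ENNReal.ofReal (Real.exp (‖a‖ ^ 2))), ← h, ← lintegral_const_mul _ (by fun_prop)]
  refine lintegral_congr fun z => ?_
  rw [← ENNReal.ofReal_mul (Real.exp_pos _).le, ← Real.exp_add, norm_add_sq_complex]
  congr 2
  simp
  ring

lemma lintegral_exp_two_re_vectorNoise (a : Fin K → ℂ) :
    ∫⁻ z, ENNReal.ofReal (Real.exp (2 * (star a ⬝ᵥ z).re)) ∂vectorNoise K
      = ENNReal.ofReal (Real.exp (normSq a)) := by
  have h := congrArg (fun μ : Measure (Fin K → ℂ) => μ Set.univ) (map_add_vectorNoise (-a))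
  simp only [measure_univ] at h
  rw [Measure.map_apply (by fun_prop) MeasurableSet.univ, Set.preimage_univ,
    withDensity_apply _ MeasurableSet.univ, setLIntegral_univ] at h
  rw [← mul_one (ENNReal.ofReal (Real.exp (normSq a))), ← h, ← lintegral_const_mul _ (by fun_prop)]
  refine lintegral_congr fun z => ?_
  rw [← ENNReal.ofReal_mul (Real.exp_pos _).le, ← Real.exp_add, normSq_add]
  congr 2
  simp [normSq]
  ring

lemma lintegral_exp_mul_normSq_dotProduct (h : Fin K → ℂ) {c : ℝ} (hc : 0 ≤ c)
    (hcG : c * normSq h < 1) :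
    ∫⁻ z, ENNReal.ofReal (Real.exp (c * ‖star h ⬝ᵥ z‖ ^ 2)) ∂vectorNoise K
      = ENNReal.ofReal ((1 - c * normSq h)⁻¹) := by
  -- `exp (c |u|²)` is the average of `exp (2 √c Re (ξ̄ u))` over `ξ ∼ CN(0,1)`.
  have hs : ‖(Real.sqrt c : ℂ)‖ ^ 2 = c := by
    rw [Complex.norm_real, Real.norm_of_nonneg (Real.sqrt_nonneg c), Real.sq_sqrt hc]
  have h1 : ∀ z : Fin K → ℂ, ENNReal.ofReal (Real.exp (c * ‖star h ⬝ᵥ z‖ ^ 2))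
      = ∫⁻ ξ, ENNReal.ofReal (Real.exp
          (2 * (star (Real.sqrt c * (star h ⬝ᵥ z)) * ξ).re)) ∂stdComplexGaussian := fun z => by
    rw [lintegral_exp_two_re_stdComplexGaussian, norm_mul, mul_pow, hs]
  have h2 : ∀ (z : Fin K → ℂ) (ξ : ℂ), (star (Real.sqrt c * (star h ⬝ᵥ z)) * ξ).re
      = (star ((Real.sqrt c * ξ) • h) ⬝ᵥ z).re := fun z ξ => by
    rw [star_smul, smul_dotProduct, ← Complex.conj_re]
    congr 1
    simp only [star_mul', map_mul, Complex.star_def, Complex.conj_conj, Complex.conj_ofReal,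
      smul_eq_mul]
    ring
  simp only [h1, h2]
  rw [lintegral_lintegral_swap]
  · simp only [lintegral_exp_two_re_vectorNoise, normSq_smul, norm_mul, mul_pow, hs]
    rw [← lintegral_exp_mul_normSq_stdComplexGaussian hcG]
    refine lintegral_congr fun ξ => ?_
    ring_nf
  · have : Measurable fun p : (Fin K → ℂ) × ℂ =>
        2 * (star ((Real.sqrt c * p.2) • h) ⬝ᵥ p.1).re := by
      simp only [dotProduct, Pi.star_apply, Pi.smul_apply, Complex.star_def]
      fun_prop
    exact (ENNReal.measurable_ofReal.comp (Real.measurable_exp.comp this)).aemeasurable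

lemma map_two_re_dotProduct_vectorNoise (a : Fin K → ℂ) :
    (vectorNoise K).map (fun z => 2 * (star a ⬝ᵥ z).re)
      = gaussianReal 0 (2 * (normSq a).toNNReal) := by
  set X : (Fin K → ℂ) → ℝ := fun z => 2 * (star a ⬝ᵥ z).re with hX
  have hXm : Measurable X := by fun_prop
  have key : ∀ t : ℝ, ∫⁻ z, ENNReal.ofReal (Real.exp (t * X z)) ∂vectorNoise K
      = ENNReal.ofReal (Real.exp (t ^ 2 * normSq a)) := fun t => by
    have := lintegral_exp_two_re_vectorNoise ((t : ℂ) • a)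
    rw [normSq_smul] at this
    simp only [Complex.norm_real, Real.norm_eq_abs, sq_abs] at this
    rw [← this]
    refine lintegral_congr fun z => ?_
    congr 2
    rw [star_smul, smul_dotProduct, hX]
    simp
    ring
  have hint : ∀ t : ℝ, Integrable (fun z => Real.exp (t * X z)) (vectorNoise K) := fun t => by
    refine ⟨by fun_prop, ?_⟩
    rw [hasFiniteIntegral_iff_ofReal (ae_of_all _ fun z => (Real.exp_pos _).le), key]
    exact ENNReal.ofReal_lt_top
  have hset : integrableExpSet X (vectorNoise K) = Set.univ := by
    ext t; simp [integrableExpSet, hint t]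
  have hmgf : mgf X (vectorNoise K) = mgf id (gaussianReal 0 (2 * (normSq a).toNNReal)) := by
    rw [mgf_id_gaussianReal]
    ext t
    rw [mgf, integral_eq_lintegral_of_nonneg_ae (ae_of_all _ fun z => (Real.exp_pos _).le)
      (hint t).1, key, ENNReal.toReal_ofReal (Real.exp_pos _).le]
    push_cast
    rw [Real.coe_toNNReal _ (normSq_nonneg a)]
    ring_nf
  have := eqOn_complexMGF_of_mgf hmgf
  rw [hset] at this
  rw [Measure.ext_of_complexMGF_eq hXm.aemeasurable (Y := id)
    (μ' := gaussianReal 0 (2 * (normSq a).toNNReal)) aemeasurable_id, Measure.map_id]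
  ext z
  exact this (by simp)

lemma memLp_re_dotProduct (a : Fin K → ℂ) :
    MemLp (fun z => (star a ⬝ᵥ z).re) 2 (vectorNoise K) := by
  have h := memLp_id_gaussianReal' (μ := 0) (v := 2 * (normSq a).toNNReal) 2 (by norm_num)
  rw [← map_two_re_dotProduct_vectorNoise a, memLp_map_measure_iff (by fun_prop) (by fun_prop)] at h
  convert h.const_mul (1 / 2) using 2
  simp

lemma integral_re_dotProduct (a : Fin K → ℂ) :
    ∫ z, (star a ⬝ᵥ z).re ∂vectorNoise K = 0 := by
  have h := integral_id_gaussianReal (μ := 0) (v := 2 * (normSq a).toNNReal)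
  rw [← map_two_re_dotProduct_vectorNoise a, integral_map (by fun_prop) (by fun_prop),
    integral_const_mul] at h
  linarith

lemma integral_re_dotProduct_sq (a : Fin K → ℂ) :
    ∫ z, (star a ⬝ᵥ z).re ^ 2 ∂vectorNoise K = normSq a / 2 := by
  have h := variance_id_gaussianReal (μ := 0) (v := 2 * (normSq a).toNNReal)
  rw [variance_of_integral_eq_zero aemeasurable_id (by simp),
    ← map_two_re_dotProduct_vectorNoise a, integral_map (by fun_prop) (by fun_prop)] at h
  simp only [id, mul_pow, integral_const_mul] at h
  push_cast at h
  rw [Real.coe_toNNReal _ (normSq_nonneg a)] at h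
  linarith

lemma re_I_smul_dotProduct (h z : Fin K → ℂ) :
    (star (Complex.I • h) ⬝ᵥ z).re = (star h ⬝ᵥ z).im := by
  rw [star_smul, smul_dotProduct]; simp

lemma memLp_dotProduct (h : Fin K → ℂ) :
    MemLp (fun z => star h ⬝ᵥ z) 2 (vectorNoise K) := by
  have h1 := (memLp_re_dotProduct h).ofReal (K := ℂ)
  have h2 := (memLp_re_dotProduct (Complex.I • h)).ofReal (K := ℂ)
  convert h1.add (h2.mul_const Complex.I) using 2 with z
  simp [Complex.re_add_im]

lemma integral_norm_dotProduct_sq (h : Fin K → ℂ) :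
    ∫ z, ‖star h ⬝ᵥ z‖ ^ 2 ∂vectorNoise K = normSq h := by
  have h1 := integral_re_dotProduct_sq h
  have h2 := integral_re_dotProduct_sq (Complex.I • h)
  have h3 : ∀ z : Fin K → ℂ, ‖star h ⬝ᵥ z‖ ^ 2
      = (star h ⬝ᵥ z).re ^ 2 + (star (Complex.I • h) ⬝ᵥ z).re ^ 2 := fun z => by
    rw [re_I_smul_dotProduct, ← Complex.normSq_eq_norm_sq, Complex.normSq_apply]; ring
  simp only [h3]
  rw [integral_add (memLp_re_dotProduct h).integrable_sq (memLp_re_dotProduct _).integrable_sq,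
    h1, h2, normSq_smul]
  simp

/-- The Gaussian law with density `(1 - c ‖h‖²) exp (c |⟨h, v⟩|²)` with respect to `CN(0,I)`;
its covariance is `I + σ h hᴴ` if `c = σ / (1 + σ ‖h‖²)`. -/
noncomputable def stretchedNoise (h : Fin K → ℂ) (c : ℝ) : Measure (Fin K → ℂ) :=
  (vectorNoise K).withDensity fun v =>
    ENNReal.ofReal ((1 - c * normSq h) * Real.exp (c * ‖star h ⬝ᵥ v‖ ^ 2))

/-- The density with respect to the law of the noise `z` that turns the law of `z + b` into
`stretchedNoise h c`: the Cameron–Martin density at `z` times the density of `stretchedNoise h c`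
at `z + b`. -/
noncomputable def tilt (h : Fin K → ℂ) (c : ℝ) (b z : Fin K → ℂ) : ENNReal :=
  ENNReal.ofReal ((1 - c * normSq h) *
    Real.exp (normSq z - normSq (z + b) + c * ‖star h ⬝ᵥ (z + b)‖ ^ 2))

lemma isProbabilityMeasure_stretchedNoise (h : Fin K → ℂ) {c : ℝ} (hc : 0 ≤ c)
    (hcG : c * normSq h < 1) : IsProbabilityMeasure (stretchedNoise h c) := by
  refine ⟨?_⟩
  rw [stretchedNoise, withDensity_apply _ MeasurableSet.univ, setLIntegral_univ]
  simp only [ENNReal.ofReal_mul (sub_pos.2 hcG).le]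
  rw [lintegral_const_mul _ (by fun_prop), lintegral_exp_mul_normSq_dotProduct h hc hcG,
    ← ENNReal.ofReal_mul (sub_pos.2 hcG).le, mul_inv_cancel₀ (sub_pos.2 hcG).ne', ENNReal.ofReal_one]

lemma _root_.Measurable.tilt {α : Type*} [MeasurableSpace α] {h : Fin K → ℂ} {c : ℝ}
    {b z : α → Fin K → ℂ} (hb : Measurable b) (hz : Measurable z) :
    Measurable fun x => tilt h c (b x) (z x) := by
  have h1 : Measurable fun x => z x + b x := hz.add hb
  have h2 : Measurable fun x => normSq (z x + b x) := measurable_normSq.comp h1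
  have h3 : Measurable fun x => star h ⬝ᵥ (z x + b x) := (measurable_dotProduct _).comp h1
  have h4 : Measurable fun x => normSq (z x) := measurable_normSq.comp hz
  unfold GaussianMulticast.tilt
  fun_prop

lemma map_add_tilt (h : Fin K → ℂ) (c : ℝ) (b : Fin K → ℂ) :
    ((vectorNoise K).withDensity (tilt h c b)).map (· + b) = stretchedNoise h c := by
  have hm : Measurable fun z : Fin K → ℂ => z + b := by fun_prop
  have hq : Measurable fun v : Fin K → ℂ =>
    ENNReal.ofReal ((1 - c * normSq h) * Real.exp (c * ‖star h ⬝ᵥ v‖ ^ 2)) := by fun_prop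
  have ht : Measurable fun z : Fin K → ℂ =>
    ENNReal.ofReal (Real.exp (normSq z - normSq (z + b))) := by fun_prop
  ext s hs
  rw [Measure.map_apply hm hs, stretchedNoise, withDensity_apply _ hs, withDensity_apply _ (hm hs)]
  conv_rhs => rw [← map_add_vectorNoise b]
  rw [setLIntegral_map hs hq hm]
  refine Eq.trans ?_ (setLIntegral_withDensity_eq_setLIntegral_mul _ ht (hq.comp hm) (hm hs)).symm
  refine lintegral_congr fun z => ?_
  rw [Pi.mul_apply, tilt, Function.comp_apply, ← ENNReal.ofReal_mul (Real.exp_pos _).le,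
    Real.exp_add]
  ring_nf

end VectorGaussian

/-! ### The change-of-measure bound -/

section Converse

/-- If a change of measure with density `exp (-ℓ)` makes the event `A` as unlikely as a blind guess
among `L` messages, then `P A * log L` exceeds the mean of the log-likelihood ratio `ℓ` by at most
`log 2`. -/
lemma measureReal_mul_log_le {Ω : Type*} [MeasurableSpace Ω] (P : Measure Ω)
    [IsProbabilityMeasure P] {ℓ : Ω → ℝ} (hℓ : Integrable ℓ P) {A : Set Ω} (hA : MeasurableSet A)
    {L : ℕ} (hL : 0 < L) (h1 : ∫⁻ ω, ENNReal.ofReal (Real.exp (-ℓ ω)) ∂P ≤ 1)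
    (h2 : ∫⁻ ω in A, ENNReal.ofReal (Real.exp (-ℓ ω)) ∂P ≤ (L : ENNReal)⁻¹) :
    P.real A * Real.log L ≤ Real.log 2 + ∫ ω, ℓ ω ∂P := by
  have hL' : (0 : ℝ) < L := by exact_mod_cast hL
  have hmeas : AEStronglyMeasurable (fun ω => Real.exp (-ℓ ω)) P :=
    Real.continuous_exp.comp_aestronglyMeasurable hℓ.1.neg
  have hint : Integrable (fun ω => Real.exp (-ℓ ω)) P := by
    refine ⟨hmeas, ?_⟩
    rw [hasFiniteIntegral_iff_ofReal (ae_of_all _ fun z => (Real.exp_pos _).le)]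
    exact h1.trans_lt ENNReal.one_lt_top
  have h1' : ∫ ω, Real.exp (-ℓ ω) ∂P ≤ 1 := by
    rw [integral_eq_lintegral_of_nonneg_ae (ae_of_all _ fun z => (Real.exp_pos _).le) hmeas]
    exact ENNReal.toReal_le_of_le_ofReal zero_le_one (by simpa using h1)
  have h2' : ∫ ω in A, Real.exp (-ℓ ω) ∂P ≤ (L : ℝ)⁻¹ := by
    rw [integral_eq_lintegral_of_nonneg_ae (ae_of_all _ fun z => (Real.exp_pos _).le)
      hmeas.restrict]
    refine ENNReal.toReal_le_of_le_ofReal (by positivity) ?_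
    rwa [ENNReal.ofReal_inv_of_pos hL', ENNReal.ofReal_natCast]
  -- `log x ≤ x - 1` at `x = exp (-ℓ) φ`, where `φ = L / 2` on `A` and `φ = 1 / 2` off `A`.
  have hpt : ∀ ω, -ℓ ω + A.indicator (fun _ => Real.log L) ω - Real.log 2
      ≤ L / 2 * A.indicator (fun ω => Real.exp (-ℓ ω)) ω + 1 / 2 * Real.exp (-ℓ ω) - 1 := by
    intro ω
    have hexp := Real.exp_pos (-ℓ ω)
    by_cases hω : ω ∈ A
    · have := Real.log_le_sub_one_of_pos (x := Real.exp (-ℓ ω) * (L / 2)) (by positivity)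
      rw [Real.log_mul hexp.ne' (by positivity), Real.log_exp,
        Real.log_div hL'.ne' (by norm_num)] at this
      simp only [Set.indicator_of_mem hω]
      linarith
    · have := Real.log_le_sub_one_of_pos (x := Real.exp (-ℓ ω) / 2) (by positivity)
      rw [Real.log_div hexp.ne' (by norm_num), Real.log_exp] at this
      simp only [Set.indicator_of_notMem hω]
      linarith
  have hi1 : Integrable (A.indicator fun _ => Real.log L) P := (integrable_const _).indicator hA
  have hi2 : Integrable (A.indicator fun ω => Real.exp (-ℓ ω)) P := hint.indicator hA
  have hle := integral_mono ((hℓ.neg.add hi1).sub (integrable_const _))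
    (((hi2.const_mul (L / 2)).add (hint.const_mul (1 / 2))).sub (integrable_const 1)) hpt
  simp only [Pi.add_apply, Pi.sub_apply, Pi.neg_apply] at hle
  rw [integral_sub (by exact hℓ.neg.add hi1) (integrable_const _),
    integral_add (by exact hℓ.neg) hi1,
    integral_sub (by exact (hi2.const_mul (L / 2)).add (hint.const_mul (1 / 2))) (integrable_const 1),
    integral_add (by exact hi2.const_mul (L / 2)) (hint.const_mul (1 / 2)), integral_const_mul,
    integral_const_mul, integral_indicator hA, integral_indicator hA, integral_neg,
    setIntegral_const] at hle
  simp only [integral_const, probReal_univ, smul_eq_mul, one_mul, mul_one] at hle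
  have : (L : ℝ) / 2 * ∫ ω in A, Real.exp (-ℓ ω) ∂P ≤ 1 / 2 := by
    calc (L : ℝ) / 2 * ∫ ω in A, Real.exp (-ℓ ω) ∂P ≤ L / 2 * (L : ℝ)⁻¹ := by gcongr
      _ = 1 / 2 := by field_simp
  linarith

variable {K N : ℕ} {M : Type*} [MeasurableSpace M]

/-- The noise at time `i` is uncorrelated with every variable that does not depend on it. -/
lemma integral_mul_causal_eq_zero (U : Measure M) [IsProbabilityMeasure U] (h : Fin K → ℂ)
    (β : M × (Fin N → Fin K → ℂ) → ℂ) (i : Fin N)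
    (hc : ∀ w z u, β (w, Function.update z i u) = β (w, z))
    (hint : Integrable (fun q : M × (Fin N → Fin K → ℂ) => β q * (star h ⬝ᵥ q.2 i))
      (U.prod (Measure.pi fun _ => vectorNoise K))) :
    ∫ q, β q * (star h ⬝ᵥ q.2 i) ∂(U.prod (Measure.pi fun _ => vectorNoise K)) = 0 := by
  rw [integral_prod _ hint]
  refine integral_eq_zero_of_ae ?_
  filter_upwards [hint.prod_right_ae] with w hw
  have hp := measurePreserving_update (ι := Fin N) (vectorNoise K) i
  rw [← hp.map_eq, integral_map hp.measurable.aemeasurable (by rw [hp.map_eq]; exact hw.1)]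
  rw [← hp.map_eq] at hw
  have hw' := (integrable_map_measure hw.1 hp.measurable.aemeasurable).1 hw
  rw [integral_prod _ (by exact hw')]
  refine integral_eq_zero_of_ae (ae_of_all _ fun z => ?_)
  have h0 : ∫ u, star h ⬝ᵥ u ∂vectorNoise K = 0 := by
    have hi := (memLp_dotProduct h).integrable (by norm_num)
    refine Complex.ext ?_ ?_
    · rw [← RCLike.re_eq_complex_re, ← integral_re hi]
      exact integral_re_dotProduct h
    · rw [← RCLike.im_eq_complex_im, ← integral_im hi]
      simpa [re_I_smul_dotProduct] using integral_re_dotProduct (Complex.I • h)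
  simp only [Function.update_self, hc, integral_const_mul, h0, mul_zero, Pi.zero_apply]

lemma log_density_identity (h z : Fin K → ℂ) (c : ℝ) (β : ℂ) :
    normSq (z + β • h) - normSq z - c * ‖star h ⬝ᵥ (z + β • h)‖ ^ 2
      = ‖β‖ ^ 2 * (normSq h * (1 - c * normSq h))
        + 2 * (1 - c * normSq h) * (star β * (star h ⬝ᵥ z)).re - c * ‖star h ⬝ᵥ z‖ ^ 2 := by
  rw [normSq_add, normSq_smul, dotProduct_add, dotProduct_smul, star_dotProduct_self,
    norm_add_sq_complex, star_smul, smul_dotProduct]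
  simp only [smul_eq_mul, norm_mul, Complex.norm_real, Real.norm_eq_abs, mul_pow, sq_abs,
    star_mul', Complex.star_def, Complex.conj_ofReal]
  have : ((starRingEnd ℂ) β * (normSq h : ℂ) * (star h ⬝ᵥ z)).re
      = normSq h * ((starRingEnd ℂ) β * (star h ⬝ᵥ z)).re := by
    rw [← Complex.re_ofReal_mul]; ring_nf
  rw [this]
  ring

lemma measurable_shift (h : Fin K → ℂ) (β : Fin N → M × (Fin N → Fin K → ℂ) → ℂ)
    (hm : ∀ i, Measurable (β i)) :
    Measurable fun q : M × (Fin N → Fin K → ℂ) =>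
      ((q.1, fun i => q.2 i + β i q • h) : M × (Fin N → Fin K → ℂ)) := by
  refine measurable_fst.prodMk (measurable_pi_lambda _ fun i => measurable_pi_lambda _ fun k => ?_)
  exact ((measurable_pi_apply k).comp ((measurable_pi_apply i).comp measurable_snd)).add
    ((hm i).mul_const (h k))

/-- If the shifts `β i q • h` are causal, reweighting by the product of the tilts makes the shifted
noise i.i.d. and independent of the message. -/
lemma map_prod_tilt (U : Measure M) [IsProbabilityMeasure U] (h : Fin K → ℂ)
    {c : ℝ} (hc0 : 0 ≤ c) (hcG : c * normSq h < 1) (β : Fin N → M × (Fin N → Fin K → ℂ) → ℂ)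
    (hc : ∀ i j, i ≤ j → ∀ w z u, β i (w, Function.update z j u) = β i (w, z))
    (hm : ∀ i, Measurable (β i)) :
    ((U.prod (Measure.pi fun _ => vectorNoise K)).withDensity
        fun q => ∏ i, tilt h c (β i q • h) (q.2 i)).map
          (fun q => (q.1, fun i => q.2 i + β i q • h))
      = U.prod (Measure.pi fun _ => stretchedNoise h c) := by
  have := isProbabilityMeasure_stretchedNoise h hc0 hcG
  have hbm : ∀ i, Measurable fun q => β i q • h := fun i =>
    measurable_pi_lambda _ fun k => (hm i).mul_const (h k)
  have hVm := measurable_shift h β hm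
  have hTm : Measurable fun q => ∏ i, tilt h c (β i q • h) (q.2 i) := by
    refine Finset.measurable_fun_prod _ fun i _ => ?_
    have hz : Measurable fun q : M × (Fin N → Fin K → ℂ) => q.2 i :=
      (measurable_pi_apply i).comp measurable_snd
    exact (hbm i).tilt hz
  ext B hB
  rw [Measure.map_apply hVm hB, withDensity_apply _ (hVm hB), ← lintegral_indicator (hVm hB),
    lintegral_prod _ (hTm.indicator (hVm hB)).aemeasurable, Measure.prod_apply hB]
  refine lintegral_congr fun w => ?_
  have hbw : ∀ i, Measurable fun z : Fin N → Fin K → ℂ => β i (w, z) • h := fun i =>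
    (hbm i).comp measurable_prodMk_left
  have hVw : Measurable fun (z : Fin N → Fin K → ℂ) i => z i + β i (w, z) • h :=
    measurable_pi_lambda _ fun i => (measurable_pi_apply i).add (hbw i)
  have hBw : MeasurableSet (Prod.mk w ⁻¹' B) := measurable_prodMk_left hB
  rw [← map_causal_shift (vectorNoise K) (stretchedNoise h c) (tilt h c)
    (measurable_fst.tilt measurable_snd) (map_add_tilt h c) (fun i z => β i (w, z) • h) hbw
    (fun i j hij z u => by simp only [hc i j hij w z u]),
    Measure.map_apply hVw hBw, withDensity_apply _ (hVw hBw), ← lintegral_indicator (hVw hBw)]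
  rfl

/-- The mean contribution of one time to the log-likelihood ratio, up to normalization. -/
lemma integral_log_density (U : Measure M) [IsProbabilityMeasure U] (h : Fin K → ℂ) (c : ℝ)
    (β : M × (Fin N → Fin K → ℂ) → ℂ) (i : Fin N)
    (hc : ∀ w z u, β (w, Function.update z i u) = β (w, z))
    (hL2 : MemLp β 2 (U.prod (Measure.pi fun _ => vectorNoise K))) :
    Integrable (fun q : M × (Fin N → Fin K → ℂ) => normSq (q.2 i + β q • h) - normSq (q.2 i)
      - c * ‖star h ⬝ᵥ (q.2 i + β q • h)‖ ^ 2) (U.prod (Measure.pi fun _ => vectorNoise K)) ∧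
    ∫ q, (normSq (q.2 i + β q • h) - normSq (q.2 i)
        - c * ‖star h ⬝ᵥ (q.2 i + β q • h)‖ ^ 2) ∂(U.prod (Measure.pi fun _ => vectorNoise K))
      = (∫ q, ‖β q‖ ^ 2 ∂(U.prod (Measure.pi fun _ => vectorNoise K)))
        * (normSq h * (1 - c * normSq h)) - c * normSq h := by
  set P := U.prod (Measure.pi fun _ : Fin N => vectorNoise K) with hP
  have hu : MeasurePreserving (fun q : M × (Fin N → Fin K → ℂ) => q.2 i) P (vectorNoise K) :=
    (measurePreserving_eval (fun _ : Fin N => vectorNoise K) i).comp measurePreserving_snd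
  have huL2 : MemLp (fun q : M × (Fin N → Fin K → ℂ) => star h ⬝ᵥ q.2 i) 2 P :=
    (memLp_dotProduct h).comp_measurePreserving hu
  have hcross : Integrable (fun q => star (β q) * (star h ⬝ᵥ q.2 i)) P :=
    hL2.star.integrable_mul huL2
  simp only [log_density_identity]
  have hi1 : Integrable (fun q => ‖β q‖ ^ 2 * (normSq h * (1 - c * normSq h))) P :=
    (hL2.integrable_norm_pow (by norm_num)).mul_const _
  have hi2 : Integrable (fun q : M × (Fin N → Fin K → ℂ) =>
      2 * (1 - c * normSq h) * (star (β q) * (star h ⬝ᵥ q.2 i)).re) P := hcross.re.const_mul _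
  have hi3 : Integrable (fun q : M × (Fin N → Fin K → ℂ) => c * ‖star h ⬝ᵥ q.2 i‖ ^ 2) P :=
    (huL2.integrable_norm_pow (by norm_num)).const_mul _
  refine ⟨(hi1.add hi2).sub hi3, ?_⟩
  have hz : ∫ q, (star (β q) * (star h ⬝ᵥ q.2 i)).re ∂P = 0 := by
    have := integral_mul_causal_eq_zero U h (fun q => star (β q)) i
      (fun w z u => by simp only [hc]) hcross
    have h' := integral_re hcross
    rw [hP, this] at h'
    simpa using h'
  have hn : ∫ q, ‖star h ⬝ᵥ q.2 i‖ ^ 2 ∂P = normSq h := by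
    rw [← integral_norm_dotProduct_sq h, ← hu.map_eq,
      integral_map hu.measurable.aemeasurable (by fun_prop)]
  rw [integral_sub (by exact hi1.add hi2) hi3, integral_add hi1 hi2, integral_mul_const,
    integral_const_mul, integral_const_mul, hz, hn]
  ring

/-- The converse bound. The noise is shifted causally along the vector `h` by amounts of mean power
at most `σ`, and the message is guessed correctly only on the event that the message and the shifted
noise `v` lie in `A`. If, for each fixed `v`, at most a fraction `1 / L` of the messages is in `A`,
then `log L` times the probability of this event is at most `log 2 + N log (1 + σ ‖h‖²)`. -/
theorem measureReal_shift_mul_log_le (U : Measure M) [IsProbabilityMeasure U] (h : Fin K → ℂ)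
    {σ : ℝ} (hσ : 0 ≤ σ) (β : Fin N → M × (Fin N → Fin K → ℂ) → ℂ)
    (hc : ∀ i j, i ≤ j → ∀ w z u, β i (w, Function.update z j u) = β i (w, z))
    (hm : ∀ i, Measurable (β i))
    (hL2 : ∀ i, MemLp (β i) 2 (U.prod (Measure.pi fun _ => vectorNoise K)))
    (hpow : ∑ i, ∫ q, ‖β i q‖ ^ 2 ∂(U.prod (Measure.pi fun _ => vectorNoise K)) ≤ N * σ)
    {A : Set (M × (Fin N → Fin K → ℂ))} (hA : MeasurableSet A) {L : ℕ} (hL : 0 < L)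
    (hAL : ∀ v, U {w | (w, v) ∈ A} ≤ (L : ENNReal)⁻¹) :
    (U.prod (Measure.pi fun _ => vectorNoise K)).real
        {q | (q.1, fun i => q.2 i + β i q • h) ∈ A} * Real.log L
      ≤ Real.log 2 + N * Real.log (1 + σ * normSq h) := by
  set P := U.prod (Measure.pi fun _ : Fin N => vectorNoise K) with hP
  set G := normSq h with hG
  have hG0 : 0 ≤ G := normSq_nonneg h
  have hD : 0 < 1 + σ * G := by positivity
  -- The reweighted law of `z i + β i • h` gets covariance `I + σ h hᴴ`, which matches the power.
  set c := σ / (1 + σ * G) with hcdef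
  have hc0 : 0 ≤ c := by positivity
  have hcG : 1 - c * G = (1 + σ * G)⁻¹ := by rw [hcdef]; field_simp; ring
  have hcG1 : c * G < 1 := by
    have : 0 < (1 + σ * G)⁻¹ := by positivity
    linarith
  have := isProbabilityMeasure_stretchedNoise h hc0 hcG1
  set V : M × (Fin N → Fin K → ℂ) → M × (Fin N → Fin K → ℂ) :=
    fun q => (q.1, fun i => q.2 i + β i q • h) with hV
  have hVm : Measurable V := measurable_shift h β hm
  set ℓ : M × (Fin N → Fin K → ℂ) → ℝ := fun q => ∑ i, (Real.log (1 + σ * G)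
    + (normSq (q.2 i + β i q • h) - normSq (q.2 i) - c * ‖star h ⬝ᵥ (q.2 i + β i q • h)‖ ^ 2))
    with hℓ
  have hT : ∀ q, ENNReal.ofReal (Real.exp (-ℓ q)) = ∏ i, tilt h c (β i q • h) (q.2 i) := by
    intro q
    unfold tilt
    rw [← ENNReal.ofReal_prod_of_nonneg fun _ _ =>
      mul_nonneg (sub_pos.2 hcG1).le (Real.exp_pos _).le]
    rw [hℓ, ← Finset.sum_neg_distrib, Real.exp_sum]
    congr 1
    refine Finset.prod_congr rfl fun i _ => ?_
    rw [hcG, ← Real.exp_log (inv_pos.2 hD), ← Real.exp_add, Real.log_inv]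
    ring_nf
  have hmap : (P.withDensity fun q => ∏ i, tilt h c (β i q • h) (q.2 i)).map V
      = U.prod (Measure.pi fun _ => stretchedNoise h c) := map_prod_tilt U h hc0 hcG1 β hc hm
  have h1 : ∫⁻ q, ENNReal.ofReal (Real.exp (-ℓ q)) ∂P ≤ 1 := by
    have := congrArg (fun μ => μ Set.univ) hmap
    simp only [measure_univ] at this
    rw [Measure.map_apply hVm MeasurableSet.univ, Set.preimage_univ,
      withDensity_apply _ MeasurableSet.univ, setLIntegral_univ] at this
    simp only [hT, this, le_refl]
  have h2 : ∫⁻ q in V ⁻¹' A, ENNReal.ofReal (Real.exp (-ℓ q)) ∂P ≤ (L : ENNReal)⁻¹ := by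
    simp only [hT]
    rw [← withDensity_apply _ (hVm hA), ← Measure.map_apply hVm hA, hmap,
      Measure.prod_apply_symm hA]
    refine (lintegral_mono fun v => hAL v).trans ?_
    simp
  have hI := fun i => integral_log_density U h c (β i) i (hc i i le_rfl) (hL2 i)
  simp only [← hP, ← hG] at hI
  have hℓi : Integrable ℓ P :=
    integrable_finsetSum _ fun i _ => (integrable_const _).add (hI i).1
  have hℓe : ∫ q, ℓ q ∂P ≤ N * Real.log (1 + σ * G) := by
    simp only [hℓ]
    rw [integral_finsetSum _ fun i _ => by exact (integrable_const _).add (hI i).1]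
    have : ∀ i, ∫ q, (Real.log (1 + σ * G) + (normSq (q.2 i + β i q • h) - normSq (q.2 i)
        - c * ‖star h ⬝ᵥ (q.2 i + β i q • h)‖ ^ 2)) ∂P
        = Real.log (1 + σ * G) + ((∫ q, ‖β i q‖ ^ 2 ∂P) * (G * (1 - c * G)) - c * G) := fun i => by
      rw [integral_add (integrable_const _) (hI i).1, (hI i).2]
      simp
    simp only [this, Finset.sum_add_distrib, Finset.sum_sub_distrib, ← Finset.sum_mul,
      Finset.sum_const, Finset.card_univ, Fintype.card_fin, nsmul_eq_mul]
    have h3 : 0 ≤ G * (1 - c * G) := by rw [hcG]; positivity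
    have h4 := mul_le_mul_of_nonneg_right hpow h3
    have h5 : σ * (G * (1 - c * G)) = c * G := by rw [hcG, hcdef]; field_simp
    have h6 : N * σ * (G * (1 - c * G)) = N * (c * G) := by rw [mul_assoc, h5]
    linarith
  exact (measureReal_mul_log_le P hℓi (hVm hA) hL h1 h2).trans (by linarith)

end Converse

/-! ### Feedback codes -/

section Codes

namespace FeedbackCode

variable {K N : ℕ} {L : Fin 2 → ℕ} (c : FeedbackCode K N L)

lemma received_eq (g : Fin 2 → Fin K → ℂ) (w : (m : Fin 2) → Fin (L m))
    (z : Fin N → Fin K → ℂ) (i : Fin N) (k : Fin K) :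
    c.received g w z i k = (∑ m, g m k * c.sent g w z m i) + z i k := by
  rw [received]; rfl

/-- Two channels with different gains and noise produce the same output if they do so at each time
for the symbols sent over the first one. -/
lemma received_congr {g g' : Fin 2 → Fin K → ℂ} {w : (m : Fin 2) → Fin (L m)}
    {z z' : Fin N → Fin K → ℂ} {n : ℕ} (h : ∀ i : Fin N, i.1 < n → ∀ k,
      (∑ m, g m k * c.sent g w z m i) + z i k = (∑ m, g' m k * c.sent g w z m i) + z' i k) :
    ∀ i : Fin N, i.1 < n → ∀ k, c.received g w z i k = c.received g' w z' i k := by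
  intro i
  induction i using WellFoundedLT.induction with
  | ind i ih =>
    intro hi k
    have hs : ∀ m, c.sent g w z m i = c.sent g' w z' m i := fun m => by
      unfold sent
      congr 1
      funext t k'
      exact ih _ (Fin.lt_def.2 t.2) (t.2.trans hi) k'
    rw [received_eq, received_eq, h i hi k]
    simp only [hs]

lemma sent_update (g : Fin 2 → Fin K → ℂ) (w : (m : Fin 2) → Fin (L m))
    (z : Fin N → Fin K → ℂ) (u : Fin K → ℂ) (m : Fin 2) {i j : Fin N} (hij : i ≤ j) :
    c.sent g w (Function.update z j u) m i = c.sent g w z m i := by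
  unfold sent
  congr 1
  funext t k
  refine (c.received_congr (n := j.1) (fun i' hi' k => ?_) _
    (lt_of_lt_of_le t.2 (Fin.le_def.1 hij)) k).symm
  rw [Function.update_of_ne (Fin.ne_of_lt (Fin.lt_def.2 hi'))]

/-- The message of a transmitter with zero gain has no influence on the channel output. -/
lemma received_eq_of_gain_eq_zero {g : Fin 2 → Fin K → ℂ} {m : Fin 2} (hg : g m = 0)
    {w w' : (m : Fin 2) → Fin (L m)} (hw : ∀ m', m' ≠ m → w m' = w' m')
    (z : Fin N → Fin K → ℂ) (i : Fin N) (k : Fin K) :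
    c.received g w z i k = c.received g w' z i k := by
  induction i using WellFoundedLT.induction generalizing k with
  | ind i ih =>
    rw [received_eq, received_eq]
    congr 1
    refine Finset.sum_congr rfl fun m' _ => ?_
    by_cases hm : m' = m
    · subst hm; simp [hg]
    · congr 1
      unfold sent
      rw [hw m' hm]
      congr 1
      funext t k'
      exact ih _ (Fin.lt_def.2 t.2) k'

lemma measurable_sent_of_measurable_received (g : Fin 2 → Fin K → ℂ) (m : Fin 2) (i : Fin N)
    (h : ∀ j < i, ∀ k, Measurable
      fun q : ((m : Fin 2) → Fin (L m)) × (Fin N → Fin K → ℂ) => c.received g q.1 q.2 j k) :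
    Measurable
      fun q : ((m : Fin 2) → Fin (L m)) × (Fin N → Fin K → ℂ) => c.sent g q.1 q.2 m i := by
  refine measurable_from_prod_countable_right fun w => ?_
  refine (c.measurable_encode m i (w m)).comp (measurable_pi_lambda _ fun t =>
    measurable_pi_lambda _ fun k => ?_)
  exact (h _ (Fin.lt_def.2 t.2) k).comp measurable_prodMk_left

lemma measurable_received (g : Fin 2 → Fin K → ℂ) (i : Fin N) (k : Fin K) :
    Measurable
      fun q : ((m : Fin 2) → Fin (L m)) × (Fin N → Fin K → ℂ) => c.received g q.1 q.2 i k := by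
  induction i using WellFoundedLT.induction generalizing k with
  | ind i ih =>
    simp only [received_eq]
    refine (Finset.measurable_fun_sum _ fun m _ => measurable_const.mul
      (c.measurable_sent_of_measurable_received g m i fun j hj k => ih j hj k)).add ?_
    exact (measurable_pi_apply k).comp ((measurable_pi_apply i).comp measurable_snd)

lemma measurable_sent (g : Fin 2 → Fin K → ℂ) (m : Fin 2) (i : Fin N) :
    Measurable
      fun q : ((m : Fin 2) → Fin (L m)) × (Fin N → Fin K → ℂ) => c.sent g q.1 q.2 m i :=
  c.measurable_sent_of_measurable_received g m i fun j _ k => c.measurable_received g j k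

variable {c}

lemma PowerConstraint.memLp {g : Fin 2 → Fin K → ℂ} (hp : c.PowerConstraint g) (m : Fin 2)
    (i : Fin N) : MemLp (fun q => c.sent g q.1 q.2 m i) 2 (messageNoiseLaw K N L) := by
  refine ⟨(c.measurable_sent g m i).aestronglyMeasurable, ?_⟩
  rw [eLpNorm_lt_top_iff_lintegral_rpow_enorm_lt_top (by norm_num) (by norm_num)]
  have h := ((Finset.single_le_sum (fun _ _ => zero_le) (Finset.mem_univ i)).trans (hp m)).trans_lt
    (ENNReal.natCast_lt_top N)
  simpa using h

lemma PowerConstraint.sum_integral_le {g : Fin 2 → Fin K → ℂ} (hp : c.PowerConstraint g)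
    (m : Fin 2) :
    ∑ i, ∫ q, ‖c.sent g q.1 q.2 m i‖ ^ 2 ∂(messageNoiseLaw K N L) ≤ N := by
  have h1 : ∀ i, ∫ q, ‖c.sent g q.1 q.2 m i‖ ^ 2 ∂(messageNoiseLaw K N L)
      = (∫⁻ q, ‖c.sent g q.1 q.2 m i‖ₑ ^ 2 ∂(messageNoiseLaw K N L)).toReal := fun i => by
    rw [integral_eq_lintegral_of_nonneg_ae (ae_of_all _ fun _ => by positivity)
      ((c.measurable_sent g m i).norm.pow_const 2).aestronglyMeasurable]
    congr 1
    refine lintegral_congr fun q => ?_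
    rw [← ofReal_norm, ENNReal.ofReal_pow (norm_nonneg _)]
  have hfin : ∀ i ∈ Finset.univ, ∫⁻ q, ‖c.sent g q.1 q.2 m i‖ₑ ^ 2 ∂(messageNoiseLaw K N L) ≠ ⊤ :=
    fun i hi => (((Finset.single_le_sum (fun _ _ => zero_le) hi).trans (hp m)).trans_lt
      (ENNReal.natCast_lt_top N)).ne
  simp only [h1]
  rw [← ENNReal.toReal_sum hfin]
  exact ENNReal.toReal_le_of_le_ofReal (by positivity) (by simpa using hp m)

end FeedbackCode

lemma isProbabilityMeasure_messageNoiseLaw (K N : ℕ) {L : Fin 2 → ℕ} (hL : ∀ m, 0 < L m) :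
    IsProbabilityMeasure (messageNoiseLaw K N L) := by
  have : ∀ m, NeZero (L m) := fun m => ⟨(hL m).ne'⟩
  unfold messageNoiseLaw noiseLaw
  infer_instance

/-- A set of message pairs on which a map to an `n'`-element type is injective has probability at
most `1 / n`, if there are `n * n'` pairs. -/
lemma uniformOn_le_of_injOn {L : Fin 2 → ℕ} (hL : ∀ m, 0 < L m) {n n' : ℕ}
    (hn : L 0 * L 1 = n * n') (S : Set ((m : Fin 2) → Fin (L m)))
    (f : ((m : Fin 2) → Fin (L m)) → Fin n') (hf : Set.InjOn f S) :
    uniformOn Set.univ S ≤ (n : ENNReal)⁻¹ := by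
  classical
  have hpos : 0 < n * n' := hn ▸ Nat.mul_pos (hL 0) (hL 1)
  have hn0 : (n : ENNReal) ≠ 0 := by
    exact_mod_cast (pos_of_mul_pos_left hpos (Nat.zero_le _)).ne'
  have hn0' : (n' : ENNReal) ≠ 0 := by
    exact_mod_cast (pos_of_mul_pos_right hpos (Nat.zero_le _)).ne'
  have hcard : Fintype.card ((m : Fin 2) → Fin (L m)) = n * n' := by
    rw [Fintype.card_pi, Fin.prod_univ_two]; simpa using hn
  rw [uniformOn_univ, hcard, ← Set.coe_toFinset S, Measure.count_apply_finset]
  have hle : S.toFinset.card ≤ n' := by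
    have := Finset.card_le_card_of_injOn (s := S.toFinset) (t := Finset.univ) f (by simp)
      (by simpa using hf)
    simpa using this
  calc (S.toFinset.card : ENNReal) / ((n * n' : ℕ) : ENNReal)
      ≤ (n' : ENNReal) / ((n * n' : ℕ) : ENNReal) := by gcongr
    _ = (n : ENNReal)⁻¹ := by
      push_cast
      rw [ENNReal.div_eq_inv_mul, ENNReal.mul_inv (Or.inl hn0) (Or.inr hn0'), mul_assoc,
        ENNReal.inv_mul_cancel hn0' (by simp), mul_one]

/-- The probability of correct decoding is at most that of any event it implies. -/
lemma one_sub_errorProb_le {K N : ℕ} {L : Fin 2 → ℕ} (hL : ∀ m, 0 < L m) (c : FeedbackCode K N L)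
    (g : Fin 2 → Fin K → ℂ) (k : Fin K)
    {A : Set (((m : Fin 2) → Fin (L m)) × (Fin N → Fin K → ℂ))}
    (hA : ∀ q, c.decode k (fun i => c.received g q.1 q.2 i k) = q.1 → q ∈ A) :
    1 - (c.errorProb g k).toReal ≤ (messageNoiseLaw K N L).real A := by
  have := isProbabilityMeasure_messageNoiseLaw K N hL
  have hY : Measurable fun q : ((m : Fin 2) → Fin (L m)) × (Fin N → Fin K → ℂ) =>
      c.decode k (fun i => c.received g q.1 q.2 i k) :=
    (c.measurable_decode k).comp (measurable_pi_lambda _ fun i => c.measurable_received g i k)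
  have hE : MeasurableSet {q : ((m : Fin 2) → Fin (L m)) × (Fin N → Fin K → ℂ) |
      c.decode k (fun i => c.received g q.1 q.2 i k) ≠ q.1} :=
    (measurableSet_eq_fun hY measurable_fst).compl
  have h := probReal_compl_eq_one_sub (μ := messageNoiseLaw K N L) hE
  rw [FeedbackCode.errorProb, ← Measure.real, ← h]
  exact measureReal_mono fun q hq => hA q (by simpa using hq)

/-- The bound on the rate of transmitter `m`, where `σ` is the mean power of the error made when its
symbol is predicted from that of transmitter `m'` with coefficient `a`. The shifted noise is the part
of the output that is not predicted from the symbol of `m'`; together with the message of `m'` it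
determines the output. -/
lemma individual_rate_bound {K N : ℕ} {L : Fin 2 → ℕ} (hL : ∀ m, 0 < L m)
    (c : FeedbackCode K N L) (g : Fin 2 → Fin K → ℂ) (hp : c.PowerConstraint g) {m m' : Fin 2}
    (hmm : m ≠ m') (a : ℂ) {σ : ℝ} (hσ : 0 ≤ σ)
    (hpow : ∑ i, ∫ q, ‖c.sent g q.1 q.2 m i - a * c.sent g q.1 q.2 m' i‖ ^ 2
      ∂(messageNoiseLaw K N L) ≤ N * σ) (k : Fin K) :
    (1 - (c.errorProb g k).toReal) * Real.log (L m)
      ≤ Real.log 2 + N * Real.log (1 + σ * ∑ i, SNR g m i) := by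
  have : ∀ m, NeZero (L m) := fun m => ⟨(hL m).ne'⟩
  have huniv : ∀ f : Fin 2 → ℂ, ∑ j, f j = f m + f m' := fun f => by
    rw [Fin.sum_univ_two]
    fin_cases m <;> fin_cases m' <;> simp_all [add_comm]
  -- With these gains, transmitter `m` is switched off.
  set g' : Fin 2 → Fin K → ℂ := fun j => if j = m then 0 else g j + a • g m with hg'
  have hg'm : g' m = 0 := by simp [hg']
  have hg'm' : g' m' = g m' + a • g m := by simp [hg', hmm.symm]
  set β : Fin N → ((m : Fin 2) → Fin (L m)) × (Fin N → Fin K → ℂ) → ℂ :=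
    fun i q => c.sent g q.1 q.2 m i - a * c.sent g q.1 q.2 m' i with hβ
  have hrec : ∀ w z i k, c.received g w z i k
      = c.received g' w (fun i => z i + β i (w, z) • g m) i k := fun w z i k => by
    refine c.received_congr (n := N) (fun i _ k => ?_) i i.2 k
    rw [huniv, huniv, hg'm, hg'm']
    simp only [hβ, Pi.zero_apply, Pi.add_apply, Pi.smul_apply, smul_eq_mul]
    ring
  set A : Set (((m : Fin 2) → Fin (L m)) × (Fin N → Fin K → ℂ)) :=
    {q | c.decode k (fun i => c.received g' q.1 q.2 i k) m = q.1 m} with hAdef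
  have hA : MeasurableSet A := by
    refine measurableSet_eq_fun ?_ ((measurable_pi_apply m).comp measurable_fst)
    exact (measurable_pi_apply m).comp ((c.measurable_decode k).comp
      (measurable_pi_lambda _ fun i => c.measurable_received g' i k))
  have hLL : L 0 * L 1 = L m * L m' := by
    fin_cases m <;> fin_cases m' <;> simp_all [mul_comm]
  have hAL : ∀ v, uniformOn Set.univ {w | (w, v) ∈ A} ≤ (L m : ENNReal)⁻¹ := fun v => by
    refine uniformOn_le_of_injOn hL hLL _ (fun w => w m') fun w hw w' hw' hww => ?_
    have hother : ∀ j, j ≠ m → w j = w' j := fun j hj => by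
      have : j = m' := by omega
      subst this; exact hww
    have hm : w m = w' m := by
      rw [← show _ = w m from hw, ← show _ = w' m from hw']
      congr 2
      funext i
      exact c.received_eq_of_gain_eq_zero hg'm hother v i k
    funext j
    by_cases hj : j = m
    · subst hj; exact hm
    · exact hother j hj
  have key := measureReal_shift_mul_log_le (uniformOn Set.univ) (g m) hσ β
    (fun i j hij w z u => by simp only [hβ, c.sent_update g w z u _ hij])
    (fun i => (c.measurable_sent g m i).sub ((c.measurable_sent g m' i).const_mul a))
    (fun i => (hp.memLp m i).sub ((hp.memLp m' i).const_mul a)) hpow hA (hL m) hAL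
  refine (mul_le_mul_of_nonneg_right (one_sub_errorProb_le hL c g k ?_)
    (Real.log_natCast_nonneg _)).trans key
  intro q hq
  simp only [hAdef, Set.mem_ofPred_eq]
  conv_rhs => rw [← hq]
  simp only [hrec]

/-- The bound on the sum rate at receiver `k`, where `σ` is the mean power of the noiseless signal at
this receiver. Only coordinate `k` of the noise is shifted, so that it becomes the received signal. -/
lemma sum_rate_bound {K N : ℕ} {L : Fin 2 → ℕ} (hL : ∀ m, 0 < L m)
    (c : FeedbackCode K N L) (g : Fin 2 → Fin K → ℂ) (hp : c.PowerConstraint g)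
    {σ : ℝ} (hσ : 0 ≤ σ) (k : Fin K)
    (hpow : ∑ i, ∫ q, ‖g 0 k * c.sent g q.1 q.2 0 i + g 1 k * c.sent g q.1 q.2 1 i‖ ^ 2
      ∂(messageNoiseLaw K N L) ≤ N * σ) :
    (1 - (c.errorProb g k).toReal) * (Real.log (L 0) + Real.log (L 1))
      ≤ Real.log 2 + N * Real.log (1 + σ) := by
  have : ∀ m, NeZero (L m) := fun m => ⟨(hL m).ne'⟩
  set β : Fin N → ((m : Fin 2) → Fin (L m)) × (Fin N → Fin K → ℂ) → ℂ :=
    fun i q => g 0 k * c.sent g q.1 q.2 0 i + g 1 k * c.sent g q.1 q.2 1 i with hβ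
  set A : Set (((m : Fin 2) → Fin (L m)) × (Fin N → Fin K → ℂ)) :=
    {q | c.decode k (fun i => q.2 i k) = q.1} with hAdef
  have hA : MeasurableSet A := by
    refine measurableSet_eq_fun ?_ measurable_fst
    exact (c.measurable_decode k).comp (measurable_pi_lambda _ fun i =>
      (measurable_pi_apply k).comp ((measurable_pi_apply i).comp measurable_snd))
  have hAL : ∀ v, uniformOn Set.univ {w | (w, v) ∈ A} ≤ ((L 0 * L 1 : ℕ) : ENNReal)⁻¹ := fun v =>
    uniformOn_le_of_injOn hL (mul_one _).symm _ (fun _ => (0 : Fin 1)) fun w hw w' hw' _ =>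
      (show _ = w from hw).symm.trans hw'
  have key := measureReal_shift_mul_log_le (uniformOn Set.univ) (Pi.single k 1) hσ β
    (fun i j hij w z u => by simp only [hβ, c.sent_update g w z u _ hij])
    (fun i => ((c.measurable_sent g 0 i).const_mul _).add ((c.measurable_sent g 1 i).const_mul _))
    (fun i => ((hp.memLp 0 i).const_mul _).add ((hp.memLp 1 i).const_mul _)) hpow hA
    (Nat.mul_pos (hL 0) (hL 1)) hAL
  have hone : normSq (Pi.single k 1 : Fin K → ℂ) = 1 := by
    rw [normSq, Finset.sum_eq_single k] <;> simp +contextual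
  have hlog : Real.log ((L 0 * L 1 : ℕ) : ℝ) = Real.log (L 0) + Real.log (L 1) := by
    push_cast
    exact Real.log_mul (by exact_mod_cast (hL 0).ne') (by exact_mod_cast (hL 1).ne')
  rw [hone, mul_one] at key
  rw [← hlog]
  refine (mul_le_mul_of_nonneg_right (one_sub_errorProb_le hL c g k ?_)
    (Real.log_natCast_nonneg _)).trans key
  intro q hq
  simp only [hAdef, Set.mem_ofPred_eq]
  conv_rhs => rw [← hq]
  congr 1
  funext i
  rw [c.received_eq, Fin.sum_univ_two]
  simp [hβ, add_comm]

end Codes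

/-! ### The outer bound -/

section OuterBound

lemma sum_integral_norm_sq_linearCombination {Ω ι : Type*} [MeasurableSpace Ω] [Fintype ι]
    {P : Measure Ω} {X Y : ι → Ω → ℂ} (hX : ∀ i, MemLp (X i) 2 P) (hY : ∀ i, MemLp (Y i) 2 P)
    (s t : ℂ) :
    ∑ i, ∫ ω, ‖s * X i ω + t * Y i ω‖ ^ 2 ∂P
      = ‖s‖ ^ 2 * ∑ i, ∫ ω, ‖X i ω‖ ^ 2 ∂P + ‖t‖ ^ 2 * ∑ i, ∫ ω, ‖Y i ω‖ ^ 2 ∂P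
        + 2 * (s * star t * ∑ i, ∫ ω, X i ω * star (Y i ω) ∂P).re := by
  rw [Finset.mul_sum, Finset.mul_sum, Finset.mul_sum, Complex.re_sum, Finset.mul_sum,
    ← Finset.sum_add_distrib, ← Finset.sum_add_distrib]
  refine Finset.sum_congr rfl fun i _ => ?_
  have hXY : Integrable (fun ω => X i ω * star (Y i ω)) P := (hX i).integrable_mul (hY i).star
  have h1 := (hX i).integrable_norm_pow (by norm_num : (2 : ℕ) ≠ 0)
  have h2 := (hY i).integrable_norm_pow (by norm_num : (2 : ℕ) ≠ 0)
  have hpt : ∀ ω, ‖s * X i ω + t * Y i ω‖ ^ 2 = ‖s‖ ^ 2 * ‖X i ω‖ ^ 2 + ‖t‖ ^ 2 * ‖Y i ω‖ ^ 2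
      + 2 * (s * star t * (X i ω * star (Y i ω))).re := fun ω => by
    rw [norm_add_sq_complex, norm_mul, norm_mul, mul_pow, mul_pow]
    have : star (t * Y i ω) * (s * X i ω) = s * star t * (X i ω * star (Y i ω)) := by
      rw [star_mul']; ring
    rw [this]; ring
  have h3 : Integrable (fun ω => s * star t * (X i ω * star (Y i ω))) P := hXY.const_mul _
  have h4 : ∫ ω, (s * star t * (X i ω * star (Y i ω))).re ∂P
      = (s * star t * ∫ ω, X i ω * star (Y i ω) ∂P).re := by
    rw [← integral_const_mul]; exact integral_re h3
  simp only [hpt]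
  have h5 : Integrable (fun ω => 2 * (s * star t * (X i ω * star (Y i ω))).re) P :=
    h3.re.const_mul 2
  rw [integral_add (by exact (h1.const_mul _).add (h2.const_mul _)) h5,
    integral_add (h1.const_mul _) (h2.const_mul _), integral_const_mul, integral_const_mul,
    integral_const_mul, h4]

/-- The bounds at a fixed block length. The correlation `ρ` is the absolute value of the average over
time of `E[X₁ X̄₂]`. -/
lemma exists_correlation {K N : ℕ} (hN : 0 < N) {L : Fin 2 → ℕ} (hL : ∀ m, 0 < L m)
    (c : FeedbackCode K N L) (g : Fin 2 → Fin K → ℂ) (hp : c.PowerConstraint g) :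
    ∃ ρ : ℝ, 0 ≤ ρ ∧ ρ ≤ 1 ∧ ∀ k,
      (∀ m, (1 - (c.errorProb g k).toReal) * Real.log (L m)
        ≤ Real.log 2 + N * Real.log (1 + (1 - ρ ^ 2) * ∑ i, SNR g m i)) ∧
      (1 - (c.errorProb g k).toReal) * (Real.log (L 0) + Real.log (L 1))
        ≤ Real.log 2 + N * Real.log
          (1 + SNR g 0 k + SNR g 1 k + 2 * ρ * Real.sqrt (SNR g 0 k * SNR g 1 k)) := by
  have hN' : (0 : ℝ) < N := by exact_mod_cast hN
  set P := messageNoiseLaw K N L with hP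
  set lam : ℂ :=
    (N : ℂ)⁻¹ * ∑ i, ∫ q, c.sent g q.1 q.2 0 i * star (c.sent g q.1 q.2 1 i) ∂P with hlam
  have hsum : ∑ i, ∫ q, c.sent g q.1 q.2 0 i * star (c.sent g q.1 q.2 1 i) ∂P = N * lam := by
    rw [hlam, mul_inv_cancel_left₀ (by exact_mod_cast hN.ne')]
  have hmom := sum_integral_norm_sq_linearCombination (P := P) (hp.memLp 0) (hp.memLp 1)
  have hp0 := hp.sum_integral_le 0
  have hp1 := hp.sum_integral_le 1
  -- The prediction coefficient `λ` needs no normalization: both powers are at most `1`.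
  have hpow0 : ∑ i, ∫ q, ‖c.sent g q.1 q.2 0 i - lam * c.sent g q.1 q.2 1 i‖ ^ 2 ∂P
      ≤ N * (1 - ‖lam‖ ^ 2) := by
    have h := hmom 1 (-lam)
    simp only [one_mul, neg_mul, ← sub_eq_add_neg] at h
    rw [h, hsum]
    have h2 : (star (-lam) * (N * lam)).re = -(N * ‖lam‖ ^ 2) := by
      rw [← Complex.normSq_eq_norm_sq, Complex.normSq_apply]; simp; ring
    rw [h2, norm_neg, norm_one]
    nlinarith [mul_le_mul_of_nonneg_left hp1 (sq_nonneg ‖lam‖)]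
  have hpow1 : ∑ i, ∫ q, ‖c.sent g q.1 q.2 1 i - star lam * c.sent g q.1 q.2 0 i‖ ^ 2 ∂P
      ≤ N * (1 - ‖lam‖ ^ 2) := by
    have h := hmom (-star lam) 1
    simp only [one_mul, neg_mul, neg_add_eq_sub] at h
    rw [h, hsum]
    have h2 : (-(star lam * star 1 * (N * lam))).re = -(N * ‖lam‖ ^ 2) := by
      rw [← Complex.normSq_eq_norm_sq, Complex.normSq_apply]; simp; ring
    rw [h2, norm_neg, norm_star, norm_one]
    nlinarith [mul_le_mul_of_nonneg_left hp0 (sq_nonneg ‖lam‖)]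
  have hσ : 0 ≤ 1 - ‖lam‖ ^ 2 := by
    have := (Finset.sum_nonneg fun i _ => integral_nonneg fun q => sq_nonneg _).trans hpow0
    exact nonneg_of_mul_nonneg_right this hN'
  refine ⟨‖lam‖, norm_nonneg _, by nlinarith [norm_nonneg lam], fun k => ⟨?_, ?_⟩⟩
  · intro m
    fin_cases m
    · exact individual_rate_bound hL c g hp (by decide) lam hσ hpow0 k
    · exact individual_rate_bound hL c g hp (by decide) (star lam) hσ hpow1 k
  · have hsq : Real.sqrt (SNR g 0 k * SNR g 1 k) = ‖g 0 k‖ * ‖g 1 k‖ := by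
      rw [SNR, SNR, ← mul_pow, Real.sqrt_sq (by positivity)]
    have hσ' : 0 ≤ SNR g 0 k + SNR g 1 k + 2 * ‖lam‖ * Real.sqrt (SNR g 0 k * SNR g 1 k) := by
      unfold SNR; positivity
    have hpow : ∑ i, ∫ q, ‖g 0 k * c.sent g q.1 q.2 0 i + g 1 k * c.sent g q.1 q.2 1 i‖ ^ 2 ∂P
        ≤ N * (SNR g 0 k + SNR g 1 k + 2 * ‖lam‖ * Real.sqrt (SNR g 0 k * SNR g 1 k)) := by
      rw [hmom, hsum, hsq]
      have hre : (g 0 k * star (g 1 k) * (N * lam)).re ≤ ‖g 0 k‖ * ‖g 1 k‖ * (N * ‖lam‖) := by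
        refine (Complex.re_le_norm _).trans (le_of_eq ?_)
        rw [norm_mul, norm_mul, norm_mul, norm_star, Complex.norm_natCast]
      have h0 := mul_le_mul_of_nonneg_left hp0 (sq_nonneg ‖g 0 k‖)
      have h1 := mul_le_mul_of_nonneg_left hp1 (sq_nonneg ‖g 1 k‖)
      unfold SNR
      linarith
    have := sum_rate_bound hL c g hp hσ' k hpow
    rwa [← add_assoc, ← add_assoc] at this

/-- The region is the projection of a closed set along the compact interval of correlations. -/
lemma isClosed_outerRegion {K : ℕ} (g : Fin 2 → Fin K → ℂ) : IsClosed (outerRegion g) := by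
  have hS : ∀ m k, 0 ≤ SNR g m k := fun m k => by unfold SNR; positivity
  set f : Fin 2 → Set.Icc (0 : ℝ) 1 → ℝ := fun m ρ =>
    Real.logb 2 (1 + (1 - (ρ : ℝ) ^ 2) * ∑ i, SNR g m i) with hf
  set f' : Fin K → Set.Icc (0 : ℝ) 1 → ℝ := fun k ρ =>
    Real.logb 2 (1 + SNR g 0 k + SNR g 1 k + 2 * (ρ : ℝ) * Real.sqrt (SNR g 0 k * SNR g 1 k))
    with hf'
  have hfc : ∀ m, Continuous (f m) := fun m => by
    refine Continuous.div_const (Continuous.log (by fun_prop) fun ρ => ?_) _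
    have h1 : (ρ : ℝ) ^ 2 ≤ 1 := pow_le_one₀ ρ.2.1 ρ.2.2
    have := mul_nonneg (sub_nonneg.2 h1) (Finset.sum_nonneg fun i (_ : i ∈ Finset.univ) => hS m i)
    positivity
  have hfc' : ∀ k, Continuous (f' k) := fun k => by
    refine Continuous.div_const (Continuous.log (by fun_prop) fun ρ => ?_) _
    have := hS 0 k
    have := hS 1 k
    have := ρ.2.1
    positivity
  have hcl : IsClosed {p : Set.Icc (0 : ℝ) 1 × (Fin 2 → ℝ) |
      p.2 0 ≤ f 0 p.1 ∧ p.2 1 ≤ f 1 p.1 ∧ ∀ k, p.2 0 + p.2 1 ≤ f' k p.1} := by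
    refine (isClosed_le (by fun_prop) ((hfc 0).comp continuous_fst)).and
      ((isClosed_le (by fun_prop) ((hfc 1).comp continuous_fst)).and ?_)
    rw [show {p : Set.Icc (0 : ℝ) 1 × (Fin 2 → ℝ) | ∀ k, p.2 0 + p.2 1 ≤ f' k p.1}
      = ⋂ k, {p | p.2 0 + p.2 1 ≤ f' k p.1} by ext; simp]
    exact isClosed_iInter fun k => isClosed_le (by fun_prop) ((hfc' k).comp continuous_fst)
  convert isClosedMap_snd_of_compactSpace _ hcl
  ext R
  constructor
  · rintro ⟨ρ, h0, h1, h⟩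
    exact ⟨(⟨ρ, h0, h1⟩, R), h, rfl⟩
  · rintro ⟨⟨ρ, R'⟩, h, rfl⟩
    exact ⟨ρ, ρ.2.1, ρ.2.2, h⟩

lemma achievable_subset_outerRegion {K : ℕ} (hK : 0 < K) (g : Fin 2 → Fin K → ℂ) :
    {R | Achievable g R} ⊆ outerRegion g := by
  rintro R ⟨hR, c, hpow, herr⟩
  have hL : ∀ N m, 0 < numMessages R N m := fun N m => Nat.ceil_pos.2 (by positivity)
  have hle1 : ∀ N k, ((c N).errorProb g k).toReal ≤ 1 := fun N k => by
    have := isProbabilityMeasure_messageNoiseLaw K N (hL N)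
    exact measureReal_le_one
  have hlog2 : 0 < Real.log 2 := Real.log_pos (by norm_num)
  have hlog : ∀ N m, (N * R m) * Real.log 2 ≤ Real.log (numMessages R N m) := fun N m => by
    rw [← Real.log_rpow (by norm_num)]
    exact Real.log_le_log (by positivity) (Nat.le_ceil _)
  set R' : ℕ → Fin 2 → ℝ := fun N m =>
    (1 - ∑ k, ((c N).errorProb g k).toReal) * R m - (N : ℝ)⁻¹ with hR'
  have hlim : Tendsto R' atTop (𝓝 R) := by
    rw [tendsto_pi_nhds]
    intro m
    have h1 : Tendsto (fun N => ∑ k, ((c N).errorProb g k).toReal) atTop (𝓝 (∑ k : Fin K, 0)) :=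
      tendsto_finsetSum _ fun k _ => by
        simpa [Function.comp_def] using (ENNReal.tendsto_toReal ENNReal.zero_ne_top).comp (herr k)
    have h2 := ((h1.const_sub 1).mul_const (R m)).sub tendsto_inv_atTop_nhds_zero_nat
    simpa using h2
  refine (isClosed_outerRegion g).mem_of_tendsto hlim ?_
  filter_upwards [eventually_gt_atTop 0] with N hN
  have hN' : (0 : ℝ) < N := by exact_mod_cast hN
  obtain ⟨ρ, h0, h1, h⟩ := exists_correlation hN (hL N) (c N) g (hpow N)
  -- From natural logarithms over a block to bits per channel use.
  have hconv : ∀ (k : Fin K) (r ℓ D : ℝ), 0 ≤ r → (N * r) * Real.log 2 ≤ ℓ →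
      (1 - ((c N).errorProb g k).toReal) * ℓ ≤ Real.log 2 + N * Real.log D →
      (1 - ∑ k, ((c N).errorProb g k).toReal) * r - (N : ℝ)⁻¹ ≤ Real.logb 2 D := by
    intro k r ℓ D hr hℓ hD
    have hsum : ((c N).errorProb g k).toReal ≤ ∑ k, ((c N).errorProb g k).toReal :=
      Finset.single_le_sum (f := fun k => ((c N).errorProb g k).toReal)
        (fun _ _ => ENNReal.toReal_nonneg) (Finset.mem_univ k)
    have hA : (1 - ∑ k, ((c N).errorProb g k).toReal) * r
        ≤ (1 - ((c N).errorProb g k).toReal) * r := by gcongr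
    have hB := mul_le_mul_of_nonneg_left hℓ (sub_nonneg.2 (hle1 N k))
    refine (sub_le_sub_right hA _).trans ?_
    rw [Real.logb, le_div_iff₀ hlog2, sub_mul, ← mul_le_mul_iff_right₀ hN', mul_sub,
      mul_inv_cancel_left₀ hN'.ne']
    linarith
  have hind : ∀ m, R' N m ≤ Real.logb 2 (1 + (1 - ρ ^ 2) * ∑ i, SNR g m i) := fun m =>
    hconv ⟨0, hK⟩ _ _ _ (hR m) (hlog N m) ((h ⟨0, hK⟩).1 m)
  refine ⟨ρ, h0, h1, hind 0, hind 1, fun k => ?_⟩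
  refine le_trans ?_ (hconv k (R 0 + R 1) _ _ (add_nonneg (hR 0) (hR 1)) ?_ (h k).2)
  · have : (0 : ℝ) < (N : ℝ)⁻¹ := by positivity
    simp only [hR']
    linarith
  · linarith [hlog N 0, hlog N 1]

end OuterBound

end GaussianMulticast

theorem theorem2 (K : ℕ) (hK : 0 < K) (g : Fin 2 → Fin K → ℂ) :
    GaussianMulticast.capacityRegion g ⊆ GaussianMulticast.outerRegion g :=
  closure_minimal (GaussianMulticast.achievable_subset_outerRegion hK g)
    (GaussianMulticast.isClosed_outerRegion g)
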